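/- Let $p\ge 0$, $C\ge 1$, $\alpha>0$, $\beta>0$, and let $(\kappa_i)_{i\ge1}$ satisfy $C^{-1}i^{-p}\le\kappa_i\le C i^{-p}$ for all $i\ge 1$. For $n\ge1$ and $f\in\ell_2$, let $P^n_f$ be the law of the sequence $Y^n=(Y_1,Y_2,\ldots)$ given by $$Y_i=\kappa_i f_i+\tfrac{1}{\sqrt n}Z_i,\qquad i\ge 1,$$ where $Z_1,Z_2,\ldots$ are independent standard normal random variables. Put on $f$ the product prior $\Pi=\bigotimes_{i\ge1}N(0,i^{-1-2\alpha})$ (which is concentrated on $\ell_2$), and let $\Pi(\cdot\mid Y^n)$ be the posterior distribution, i.e. (any version of) the regular conditional distribution of $f$ given $Y^n$ when $f\sim\Pi$ and $Y^n\mid f\sim P^n_f$. Let $\|f\|=(\sum_i f_i^2)^{1/2}$, and $\|f\|_\beta=(\sum_i f_i^2 i^{2\beta})^{1/2}$ for $f$ in the Sobolev space $S^\beta=\{f\in\ell_2:\|f\|_\beta<\infty\}$. Then for every $R>0$ and every real sequence $M_n\to\infty$, $$\sup_{f_0\in S^\beta,\ \|f_0\|_\beta\le R}\mathbb E_{f_0}\,\Pi\Bigl(f:\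 \|f-f_0\|\ge M_n\, n^{-\frac{\alpha\wedge\beta}{1+2\alpha+2p}}\Bigm| Y^n\Bigr)\longrightarrow 0\qquad (n\to\infty),$$ where $\mathbb E_{f_0}$ denotes expectation over $Y^n\sim P^n_{f_0}$. -/

import Mathlib

open MeasureTheory ProbabilityTheory Filter Topology
open scoped ENNReal NNReal

namespace SeqModel

/-! Sequences `(x₁, x₂, …)` are functions on `ℕ`; the entry `x i` is the mathematical `x_{i+1}`,
so the mathematical index of `x i` is `(i : ℝ) + 1`. -/

/-- The `ℓ₂`-norm `(∑ f_i²)^{1/2}`, with value `∞` outside `ℓ₂`. -/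
noncomputable def ell2Norm (f : ℕ → ℝ) : ℝ≥0∞ :=
  (∑' i, ENNReal.ofReal (f i ^ 2)) ^ (1 / 2 : ℝ)

/-- The Sobolev norm `‖f‖_β = (∑ f_i² i^{2β})^{1/2}`, with value `∞` outside `S^β`. -/
noncomputable def sobolevNorm (β : ℝ) (f : ℕ → ℝ) : ℝ≥0∞ :=
  (∑' i : ℕ, ENNReal.ofReal (f i ^ 2 * ((i : ℝ) + 1) ^ (2 * β))) ^ (1 / 2 : ℝ)

/-- The Sobolev space `S^β`, a subset of `ℓ₂`. -/
def sobolevSpace (β : ℝ) : Set (ℕ → ℝ) :=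
  {f | ell2Norm f < ∞ ∧ sobolevNorm β f < ∞}

/-- The Sobolev ball `{f ∈ S^β : ‖f‖_β ≤ R}`. -/
def sobolevBall (β R : ℝ) : Set (ℕ → ℝ) :=
  {f | f ∈ sobolevSpace β ∧ sobolevNorm β f ≤ ENNReal.ofReal R}

/-- The product prior `⊗ N(0, i^{-1-2α})`. -/
noncomputable def prior (α : ℝ) : Measure (ℕ → ℝ) :=
  Measure.infinitePi fun i : ℕ => gaussianReal 0 (((i : ℝ) + 1) ^ (-1 - 2 * α)).toNNReal

/-- The law of a sequence `Z` of independent standard normal variables. -/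
noncomputable def noise : Measure (ℕ → ℝ) :=
  Measure.infinitePi fun _ : ℕ => gaussianReal 0 1

instance (α : ℝ) : IsProbabilityMeasure (prior α) := by
  unfold prior; infer_instance

instance : IsProbabilityMeasure noise := by
  unfold noise; infer_instance

/-- The observation `Y_i = κ_i f_i + n^{-1/2} Z_i`. -/
noncomputable def observe (κ : ℕ → ℝ) (n : ℕ) (f z : ℕ → ℝ) : ℕ → ℝ :=
  fun i => κ i * f i + 1 / √(n : ℝ) * z i

lemma measurable_observe (κ : ℕ → ℝ) (n : ℕ) :
    Measurable fun q : (ℕ → ℝ) × (ℕ → ℝ) => observe κ n q.1 q.2 := by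
  unfold observe; fun_prop

/-- The statistical model: `sampleLaw κ n f` is the law of the observation `Y` when the parameter
is `f`. -/
noncomputable def sampleLaw (κ : ℕ → ℝ) (n : ℕ) : Kernel (ℕ → ℝ) (ℕ → ℝ) where
  toFun f := noise.map (observe κ n f)
  measurable' := by
    have h : (fun f => noise.map (observe κ n f)) =
        fun f => (noise.map (Prod.mk f)).map
          (fun q : (ℕ → ℝ) × (ℕ → ℝ) => observe κ n q.1 q.2) := by
      funext f
      rw [Measure.map_map (measurable_observe κ n) (by fun_prop)]
      rfl
    rw [h]
    exact (Measure.measurable_map _ (measurable_observe κ n)).comp Measurable.map_prodMk_left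

instance (κ : ℕ → ℝ) (n : ℕ) : IsMarkovKernel (sampleLaw κ n) where
  isProbabilityMeasure f := by
    have : Measurable (observe κ n f) := by unfold observe; fun_prop
    exact Measure.isProbabilityMeasure_map this.aemeasurable

/-- `post` is (a version of) the posterior distribution for the prior `π` and the model `P`:
if `f ∼ π` and `Y | f ∼ P f`, then `post` is a regular conditional distribution of `f` given `Y`.
Here `P ∘ₘ π` is the marginal law of `Y`, and both sides are the joint law of `(Y, f)`. -/
def IsPosterior {Θ 𝓨 : Type*} [MeasurableSpace Θ] [MeasurableSpace 𝓨]
    (π : Measure Θ) (P : Kernel Θ 𝓨) (post : Kernel 𝓨 Θ) : Prop :=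
  (P ∘ₘ π) ⊗ₘ post = (π ⊗ₘ P).map Prod.swap

/-- Posterior distributions exist. -/
lemma isPosterior_posterior (α : ℝ) (κ : ℕ → ℝ) (n : ℕ) :
    IsPosterior (prior α) (sampleLaw κ n) (posterior (sampleLaw κ n) (prior α)) :=
  compProd_posterior_eq_map_swap

end SeqModel

/-! Prior and likelihood are Gaussian and diagonal, so one posterior is explicit
(`isPosterior_affineKernel`): independent coordinates with mean `c i * Y i` and variance `s i ^ 2`.
Integrating `‖f - f₀‖²` over this posterior and then over `Y` gives, in each coordinate, squared
bias plus variance of the posterior mean plus posterior variance. With `q = 1 + 2α + 2p` and `j = i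
+ 1`, these are at most constants times `f₀ᵢ² / (1 + n j^{-q})²` and `j^{-1-2α} / (1 + n j^{-q})`
(`coordinate_risk_le`). The first sums to order `n^{-2(α∧β)/q}` uniformly on the Sobolev ball
(`inv_one_add_sq_le`), the second to order `n^{-2α/q}` (`tsum_variance_le`). Markov's inequality
then bounds the expected posterior mass by a constant over `M n ^ 2`.

An arbitrary version of the posterior agrees with the explicit one only almost everywhere for the
marginal law of `Y`, whereas the expectation is under `f₀`. Hence the sampling law at `f₀` must be
dominated by the marginal. A marginal null set is null under almost every parameter `f`; almost
every `f` lies in `ℓ₂`; and the sampling laws at two points of `ℓ₂` are mutually absolutely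
continuous by Cameron–Martin, which comes from the product criterion
`infinitePi_absolutelyContinuous`. -/

namespace SeqModel

/-! ### Infinite product measures -/

section Product

variable {ι : Type*} {X : ι → Type*} [∀ i, MeasurableSpace (X i)]

/-- A finite product of measures with densities has the product density. -/
lemma pi_eq_withDensity [Fintype ι] (μ ν : ∀ i, Measure (X i)) [∀ i, IsProbabilityMeasure (μ i)]
    [∀ i, IsProbabilityMeasure (ν i)] (d : ∀ i, X i → ℝ≥0∞) (hd : ∀ i, Measurable (d i))
    (h : ∀ i, ν i = (μ i).withDensity (d i)) :
    Measure.pi ν = (Measure.pi μ).withDensity fun x => ∏ i, d i (x i) := by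
  classical
  refine Measure.pi_eq fun s hs => ?_
  have hms : MeasurableSet (Set.univ.pi s) := MeasurableSet.univ_pi hs
  rw [withDensity_apply _ hms, ← lintegral_indicator hms]
  have hfun : (Set.univ.pi s).indicator (fun x : ∀ i, X i => ∏ i, d i (x i)) =
      fun x => ∏ i, (s i).indicator (d i) (x i) := by
    funext x
    by_cases hx : x ∈ Set.univ.pi s
    · rw [Set.indicator_of_mem hx]
      exact Finset.prod_congr rfl fun i _ => (Set.indicator_of_mem (hx i trivial) _).symm
    · rw [Set.indicator_of_notMem hx]
      simp only [Set.mem_univ_pi, not_forall] at hx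
      obtain ⟨i, hi⟩ := hx
      exact (Finset.prod_eq_zero (Finset.mem_univ i) (Set.indicator_of_notMem hi _)).symm
  have hmeas : ∀ i, Measurable ((s i).indicator (d i)) := fun i => (hd i).indicator (hs i)
  rw [hfun, lintegral_prod_eq_prod_lintegral_of_indepFun Finset.univ
    (fun i (x : ∀ i, X i) => (s i).indicator (d i) (x i))
    (iIndepFun_pi fun i => (hmeas i).aemeasurable)
    (fun i => (hmeas i).comp (measurable_pi_apply i))]
  refine Finset.prod_congr rfl fun i _ => ?_
  rw [(measurePreserving_eval μ i).lintegral_comp (hmeas i), lintegral_indicator (hs i), h i,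
    withDensity_apply _ (hs i)]

lemma lintegral_pi_prod [Fintype ι] (μ : ∀ i, Measure (X i)) [∀ i, IsProbabilityMeasure (μ i)]
    (d : ∀ i, X i → ℝ≥0∞) (hd : ∀ i, Measurable (d i)) :
    ∫⁻ x, ∏ i, d i (x i) ∂(Measure.pi μ) = ∏ i, ∫⁻ y, d i y ∂(μ i) := by
  rw [lintegral_prod_eq_prod_lintegral_of_indepFun Finset.univ
    (fun i (x : ∀ i, X i) => d i (x i))
    (iIndepFun_pi fun i => (hd i).aemeasurable)
    (fun i => (hd i).comp (measurable_pi_apply i))]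
  exact Finset.prod_congr rfl fun i _ => (measurePreserving_eval μ i).lintegral_comp (hd i)

/-- Cauchy–Schwarz for `D` and the indicator of `S`. Applied to finite products, it gives a bound
that does not depend on the number of coordinates. -/
lemma withDensity_le_sqrt_mul {Ω : Type*} [MeasurableSpace Ω] (μ : Measure Ω) (D : Ω → ℝ≥0∞)
    (hD : Measurable D) {S : Set Ω} (hS : MeasurableSet S) :
    μ.withDensity D S ≤ (∫⁻ x, D x ^ 2 ∂μ) ^ (1 / 2 : ℝ) * μ S ^ (1 / 2 : ℝ) := by
  have hm : Measurable (S.indicator fun _ => (1 : ℝ≥0∞)) := measurable_const.indicator hS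
  have key := ENNReal.lintegral_mul_le_Lp_mul_Lq μ Real.HolderConjugate.two_two
    hD.aemeasurable hm.aemeasurable
  have h1 : ∫⁻ x, (D * S.indicator fun _ => (1 : ℝ≥0∞)) x ∂μ = μ.withDensity D S := by
    rw [withDensity_apply _ hS, ← lintegral_indicator hS]
    refine lintegral_congr fun x => ?_
    by_cases hx : x ∈ S <;> simp [hx]
  have h2 : ∫⁻ x, (S.indicator (fun _ => (1 : ℝ≥0∞)) x) ^ (2 : ℝ) ∂μ = μ S := by
    rw [← lintegral_indicator_one hS]
    refine lintegral_congr fun x => ?_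
    by_cases hx : x ∈ S <;> simp [hx]
  rw [h1, h2] at key
  simpa [ENNReal.rpow_two] using key

/-- A criterion in the style of Kakutani: if the products of the second moments of the densities
`dνᵢ/dμᵢ` are bounded, then the product of the `νᵢ` is absolutely continuous with respect to the
product of the `μᵢ`. -/
theorem infinitePi_absolutelyContinuous (μ ν : ∀ i, Measure (X i))
    [∀ i, IsProbabilityMeasure (μ i)] [∀ i, IsProbabilityMeasure (ν i)]
    (d : ∀ i, X i → ℝ≥0∞) (hd : ∀ i, Measurable (d i))
    (h : ∀ i, ν i = (μ i).withDensity (d i)) (K : ℝ≥0∞) (hK : K ≠ ∞)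
    (hdK : ∀ I : Finset ι, ∏ i ∈ I, ∫⁻ x, d i x ^ 2 ∂(μ i) ≤ K) :
    Measure.infinitePi ν ≪ Measure.infinitePi μ := by
  have hcyl : ∀ A ∈ measurableCylinders X, Measure.infinitePi ν A ≤
      K ^ (1 / 2 : ℝ) * (Measure.infinitePi μ A) ^ (1 / 2 : ℝ) := by
    intro A hA
    obtain ⟨I, S, hS, rfl⟩ := (mem_measurableCylinders A).1 hA
    rw [Measure.infinitePi_cylinder _ hS, Measure.infinitePi_cylinder _ hS,
      pi_eq_withDensity (fun i : I => μ i) (fun i : I => ν i) (fun i => d i) (fun i => hd i)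
        (fun i => h i)]
    refine (withDensity_le_sqrt_mul _ _ (by fun_prop) hS).trans ?_
    gcongr
    simp_rw [← Finset.prod_pow]
    rw [lintegral_pi_prod (fun i : I => μ i) (fun i y => d i y ^ 2) (fun i => (hd i).pow_const 2),
      Finset.univ_eq_attach, Finset.prod_attach I fun i => ∫⁻ y, d i y ^ 2 ∂(μ i)]
    exact hdK I
  refine Measure.AbsolutelyContinuous.mk fun A hA hA0 => ?_
  have hbound : ∀ ε : ℝ≥0∞, 0 < ε →
      Measure.infinitePi ν A ≤ K ^ (1 / 2 : ℝ) * ε ^ (1 / 2 : ℝ) + ε := by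
    intro ε hε
    -- Approximating `A` by a cylinder for the sum of both measures makes `t` small under the first
    -- and close to `A` under the second, so the cylinder bound passes to `A`.
    obtain ⟨t, ht, hlt⟩ := exists_measure_symmDiff_lt_of_generateFrom_isSetRing
      (μ := Measure.infinitePi μ + Measure.infinitePi ν)
      (isSetRing_measurableCylinders (α := X))
      ⟨{Set.univ}, Set.countable_singleton _, by
        simpa using isSetAlgebra_measurableCylinders.univ_mem, by simp⟩
      generateFrom_measurableCylinders.symm hA hε
    rw [Measure.add_apply] at hlt
    have h1 : Measure.infinitePi μ t ≤ ε := by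
      calc Measure.infinitePi μ t ≤ Measure.infinitePi μ (A ∪ symmDiff t A) :=
            measure_mono fun x hx => by
              by_cases hxA : x ∈ A
              · exact Or.inl hxA
              · exact Or.inr (Or.inl ⟨hx, hxA⟩)
        _ ≤ Measure.infinitePi μ A + Measure.infinitePi μ (symmDiff t A) := measure_union_le _ _
        _ ≤ ε := by rw [hA0, zero_add]; exact le_self_add.trans hlt.le
    calc Measure.infinitePi ν A ≤ Measure.infinitePi ν (t ∪ symmDiff t A) :=
          measure_mono fun x hx => by
            by_cases hxt : x ∈ t
            · exact Or.inl hxt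
            · exact Or.inr (Or.inr ⟨hx, hxt⟩)
      _ ≤ Measure.infinitePi ν t + Measure.infinitePi ν (symmDiff t A) := measure_union_le _ _
      _ ≤ K ^ (1 / 2 : ℝ) * ε ^ (1 / 2 : ℝ) + ε := by
          gcongr
          · exact (hcyl t ht).trans (by gcongr)
          · exact le_add_self.trans hlt.le
  have hlim : Tendsto (fun ε : ℝ≥0∞ => K ^ (1 / 2 : ℝ) * ε ^ (1 / 2 : ℝ) + ε) (𝓝[>] 0) (𝓝 0) := by
    have h1 : Tendsto (fun ε : ℝ≥0∞ => ε ^ (1 / 2 : ℝ)) (𝓝 0) (𝓝 0) := by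
      have := (ENNReal.continuous_rpow_const (y := (1 / 2 : ℝ))).tendsto 0
      rwa [ENNReal.zero_rpow_of_pos (by norm_num)] at this
    have h2 := (ENNReal.Tendsto.const_mul (a := K ^ (1 / 2 : ℝ)) h1
      (Or.inr (ENNReal.rpow_ne_top_of_nonneg (by norm_num) hK))).add tendsto_id
    simp only [mul_zero, add_zero] at h2
    exact h2.mono_left nhdsWithin_le_nhds
  exact le_antisymm (ge_of_tendsto hlim (eventually_mem_nhdsWithin.mono hbound)) bot_le

lemma isPiSystem_measurable_squareCylinders :
    IsPiSystem (squareCylinders fun i => {s : Set (X i) | MeasurableSet s}) :=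
  isPiSystem_squareCylinders (fun _ => MeasurableSpace.isPiSystem_measurableSet)
    (fun _ => MeasurableSet.univ)

/-- The whole space, as a finite spanning family of boxes. -/
def finiteSpanningSetsIn_squareCylinders (ρ : Measure (∀ i, X i)) [IsProbabilityMeasure ρ] :
    ρ.FiniteSpanningSetsIn (squareCylinders fun i => {s : Set (X i) | MeasurableSet s}) where
  set _ := Set.univ
  set_mem _ := ⟨∅, fun _ => Set.univ, fun _ _ => MeasurableSet.univ, by simp⟩
  finite _ := measure_lt_top _ _
  spanning := Set.iUnion_const _

/-- A product of product measures is the product of the pairs. -/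
lemma infinitePi_prod_map_split {Y : ι → Type*} [∀ i, MeasurableSpace (Y i)]
    (μ : ∀ i, Measure (X i)) (ν : ∀ i, Measure (Y i))
    [∀ i, IsProbabilityMeasure (μ i)] [∀ i, IsProbabilityMeasure (ν i)] :
    (Measure.infinitePi fun i => (μ i).prod (ν i)).map
        (fun q => ((fun i => (q i).1, fun i => (q i).2) : (∀ i, X i) × (∀ i, Y i))) =
      (Measure.infinitePi μ).prod (Measure.infinitePi ν) := by
  classical
  refine (Measure.prod_eq_generateFrom generateFrom_squareCylinders generateFrom_squareCylinders
    isPiSystem_measurable_squareCylinders isPiSystem_measurable_squareCylinders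
    (finiteSpanningSetsIn_squareCylinders (Measure.infinitePi μ))
    (finiteSpanningSetsIn_squareCylinders (Measure.infinitePi ν)) ?_).symm
  rintro _ ⟨s, t, ht, rfl⟩ _ ⟨s', t', ht', rfl⟩
  have ht : ∀ i, MeasurableSet (t i) := fun i => ht i trivial
  have ht' : ∀ i, MeasurableSet (t' i) := fun i => ht' i trivial
  -- Padding with `univ` lets both boxes be written over the common index set `s ∪ s'`; the added
  -- factors have mass 1.
  set u : ∀ i, Set (X i) := fun i => if i ∈ s then t i else Set.univ
  set u' : ∀ i, Set (Y i) := fun i => if i ∈ s' then t' i else Set.univ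
  have hu : ∀ i, MeasurableSet (u i) := fun i => by
    by_cases hi : i ∈ s <;> simp [u, hi, ht]
  have hu' : ∀ i, MeasurableSet (u' i) := fun i => by
    by_cases hi : i ∈ s' <;> simp [u', hi, ht']
  rw [Measure.map_apply (by fun_prop) ((MeasurableSet.pi s.countable_toSet fun i _ => ht i).prod
    (MeasurableSet.pi s'.countable_toSet fun i _ => ht' i))]
  have hset : (fun q : ∀ i, X i × Y i =>
        ((fun i => (q i).1, fun i => (q i).2) : (∀ i, X i) × (∀ i, Y i))) ⁻¹'
      ((s : Set ι).pi t ×ˢ (s' : Set ι).pi t') =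
      ((s ∪ s' : Finset ι) : Set ι).pi fun i => u i ×ˢ u' i := by
    ext q
    simp only [Set.mem_preimage, Set.mem_prod, Set.mem_pi, Finset.mem_coe, Finset.mem_union, u, u']
    constructor
    · rintro ⟨h1, h2⟩ i -
      constructor
      · split_ifs with hi
        · exact h1 i hi
        · trivial
      · split_ifs with hi
        · exact h2 i hi
        · trivial
    · intro H
      refine ⟨fun i hi => ?_, fun i hi => ?_⟩
      · simpa [hi] using (H i (Or.inl hi)).1
      · simpa [hi] using (H i (Or.inr hi)).2
  rw [hset, Measure.infinitePi_pi _ (fun i _ => (hu i).prod (hu' i)),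
    Measure.infinitePi_pi _ (fun i _ => ht i), Measure.infinitePi_pi _ (fun i _ => ht' i)]
  simp_rw [Measure.prod_prod]
  rw [Finset.prod_mul_distrib]
  congr 1
  · rw [← Finset.prod_subset (Finset.subset_union_left (s₂ := s')) (fun i _ hi => by simp [u, hi])]
    exact Finset.prod_congr rfl fun i hi => by simp [u, hi]
  · rw [← Finset.prod_subset (Finset.subset_union_right (s₁ := s)) (fun i _ hi => by simp [u', hi])]
    exact Finset.prod_congr rfl fun i hi => by simp [u', hi]

end Product

/-! ### Gaussian shifts -/

lemma gaussianReal_eq_withDensity_shift (h : ℝ) :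
    gaussianReal h 1 = (gaussianReal 0 1).withDensity
      fun x => ENNReal.ofReal (Real.exp (h * x - h ^ 2 / 2)) := by
  rw [gaussianReal_of_var_ne_zero _ one_ne_zero, gaussianReal_of_var_ne_zero _ one_ne_zero,
    ← withDensity_mul _ (measurable_gaussianPDF 0 1) (by fun_prop)]
  congr 1
  funext x
  simp only [Pi.mul_apply, gaussianPDF]
  rw [← ENNReal.ofReal_mul (gaussianPDFReal_nonneg _ _ _)]
  congr 1
  simp only [gaussianPDFReal]
  rw [mul_assoc _ (Real.exp _), ← Real.exp_add]
  congr 2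
  push_cast
  ring

/-- The second moment is exponential in `h ^ 2`, so products over coordinates stay bounded as soon
as the shift is in `ℓ₂`. -/
lemma lintegral_gaussian_shift_sq (h : ℝ) :
    ∫⁻ x, ENNReal.ofReal (Real.exp (h * x - h ^ 2 / 2)) ^ 2 ∂(gaussianReal 0 1) =
      ENNReal.ofReal (Real.exp (h ^ 2)) := by
  have h1 : ∀ x : ℝ, ENNReal.ofReal (Real.exp (h * x - h ^ 2 / 2)) ^ 2 =
      ENNReal.ofReal (Real.exp (-h ^ 2) * Real.exp (2 * h * x)) := fun x => by
    rw [← ENNReal.ofReal_pow (Real.exp_pos _).le, ← Real.exp_nat_mul, ← Real.exp_add]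
    congr 2
    push_cast
    ring
  simp_rw [h1]
  rw [← ofReal_integral_eq_lintegral_ofReal
    ((integrable_exp_mul_gaussianReal (2 * h)).const_mul _)
    (ae_of_all _ fun x => by positivity), integral_const_mul]
  have h2 : ∫ x, Real.exp (2 * h * x) ∂(gaussianReal 0 1) = Real.exp (2 * h ^ 2) := by
    have := congrFun (mgf_id_gaussianReal (μ := 0) (v := 1)) (2 * h)
    simp only [mgf, id] at this
    rw [this]
    congr 1
    push_cast
    ring
  rw [h2, ← Real.exp_add]
  congr 2
  ring

/-- The Cameron–Martin theorem for Gaussian white noise: shifts by elements of `ℓ₂` give absolutely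
continuous laws. -/
lemma noise_map_add_absolutelyContinuous {h : ℕ → ℝ} (hh : Summable fun i => h i ^ 2) :
    noise.map (fun z i => z i + h i) ≪ noise := by
  have hmap : noise.map (fun z i => z i + h i) = Measure.infinitePi fun i => gaussianReal (h i) 1 := by
    unfold noise
    rw [Measure.infinitePi_map_pi _ (f := fun i x => x + h i) (fun i => by fun_prop)]
    simp [gaussianReal_map_add_const]
  rw [hmap]
  refine infinitePi_absolutelyContinuous _ _
    (fun i x => ENNReal.ofReal (Real.exp (h i * x - h i ^ 2 / 2))) (fun i => by fun_prop)
    (fun i => gaussianReal_eq_withDensity_shift (h i))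
    (ENNReal.ofReal (Real.exp (∑' i, h i ^ 2))) ENNReal.ofReal_ne_top fun I => ?_
  simp_rw [lintegral_gaussian_shift_sq]
  rw [← ENNReal.ofReal_prod_of_nonneg (fun i _ => (Real.exp_pos _).le), ← Real.exp_sum]
  gcongr
  exact hh.sum_le_tsum I fun i _ => sq_nonneg _

lemma measurable_observe_right (κ : ℕ → ℝ) (n : ℕ) (f : ℕ → ℝ) : Measurable (observe κ n f) := by
  unfold observe; fun_prop

lemma sampleLaw_apply (κ : ℕ → ℝ) (n : ℕ) (f : ℕ → ℝ) :
    sampleLaw κ n f = noise.map (observe κ n f) := rfl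

/-- Changing `g` into `f` amounts to shifting the noise by `√n κ (f - g)`. -/
lemma sampleLaw_absolutelyContinuous {κ f g : ℕ → ℝ} {n : ℕ} (hn : 1 ≤ n)
    (h : Summable fun i => (κ i * (f i - g i)) ^ 2) :
    sampleLaw κ n f ≪ sampleLaw κ n g := by
  have hn0 : √(n : ℝ) ≠ 0 := by positivity
  have hsum : Summable fun i => (√(n : ℝ) * (κ i * (f i - g i))) ^ 2 := by
    simpa only [mul_pow] using h.mul_left (√(n : ℝ) ^ 2)
  have hac := (noise_map_add_absolutelyContinuous hsum).map (measurable_observe_right κ n g)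
  rw [Measure.map_map (measurable_observe_right κ n g) (by fun_prop)] at hac
  rw [sampleLaw_apply, sampleLaw_apply]
  convert hac using 2
  funext z i
  simp only [observe, Function.comp]
  field_simp
  ring

/-! ### Second moments, and domination of the sampling laws by the marginal law -/

lemma integral_sq_gaussianReal (v : ℝ≥0) : ∫ x, x ^ 2 ∂(gaussianReal 0 v) = v := by
  have h := variance_fun_id_gaussianReal (μ := 0) (v := v)
  rwa [variance_of_integral_eq_zero (by fun_prop) (by simp)] at h

lemma lintegral_affine_sq_gaussianReal (u s : ℝ) (v : ℝ≥0) :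
    ∫⁻ x, ENNReal.ofReal ((u + s * x) ^ 2) ∂(gaussianReal 0 v) =
      ENNReal.ofReal (u ^ 2 + s ^ 2 * v) := by
  have hi1 : Integrable (fun x : ℝ => x) (gaussianReal 0 v) :=
    (memLp_id_gaussianReal 1).integrable (by simp)
  have hi2 : Integrable (fun x : ℝ => x ^ 2) (gaussianReal 0 v) :=
    (memLp_id_gaussianReal 2).integrable_sq
  have hexp : (fun x : ℝ => (u + s * x) ^ 2) = fun x => u ^ 2 + 2 * u * s * x + s ^ 2 * x ^ 2 := by
    funext x; ring
  have hi12 : Integrable (fun x : ℝ => u ^ 2 + 2 * u * s * x) (gaussianReal 0 v) :=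
    (integrable_const _).add (hi1.const_mul _)
  rw [← ofReal_integral_eq_lintegral_ofReal _ (ae_of_all _ fun x => sq_nonneg _)]
  · congr 1
    rw [hexp, integral_add hi12 (hi2.const_mul _),
      integral_add (integrable_const _) (hi1.const_mul _), integral_const_mul, integral_const_mul,
      integral_sq_gaussianReal, integral_id_gaussianReal]
    simp
  · rw [hexp]
    exact hi12.add (hi2.const_mul _)

lemma lintegral_noise_affine_sq (u s : ℝ) (i : ℕ) :
    ∫⁻ z, ENNReal.ofReal ((u + s * z i) ^ 2) ∂noise = ENNReal.ofReal (u ^ 2 + s ^ 2) := by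
  have := (measurePreserving_eval_infinitePi (fun _ : ℕ => gaussianReal 0 1) i).lintegral_comp
    (f := fun x => ENNReal.ofReal ((u + s * x) ^ 2)) (by fun_prop)
  rw [lintegral_affine_sq_gaussianReal] at this
  simpa [noise] using this

lemma summable_sq_of_tsum_ne_top {f : ℕ → ℝ} (h : ∑' i, ENNReal.ofReal (f i ^ 2) ≠ ∞) :
    Summable fun i => f i ^ 2 := by
  simpa [ENNReal.toReal_ofReal, sq_nonneg] using ENNReal.summable_toReal h

lemma ae_prior_summable_sq {α : ℝ} (hα : 0 < α) :
    ∀ᵐ f ∂(prior α), Summable fun i => f i ^ 2 := by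
  have hm : Measurable fun f : ℕ → ℝ => ∑' i, ENNReal.ofReal (f i ^ 2) :=
    Measurable.tsum fun i => by fun_prop
  have hsum : Summable fun i : ℕ => ((i : ℝ) + 1) ^ (-1 - 2 * α) := by
    have := (summable_nat_add_iff 1).2
      (Real.summable_nat_rpow (p := -1 - 2 * α) |>.2 (by linarith))
    simpa using this
  have hint : ∫⁻ f, ∑' i, ENNReal.ofReal (f i ^ 2) ∂(prior α) ≠ ∞ := by
    rw [lintegral_tsum fun i => Measurable.aemeasurable (by fun_prop)]
    have : ∀ i : ℕ, ∫⁻ f, ENNReal.ofReal (f i ^ 2) ∂(prior α) =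
        ENNReal.ofReal (((i : ℝ) + 1) ^ (-1 - 2 * α)) := fun i => by
      have := (measurePreserving_eval_infinitePi
        (fun i : ℕ => gaussianReal 0 (((i : ℝ) + 1) ^ (-1 - 2 * α)).toNNReal) i).lintegral_comp
        (f := fun x => ENNReal.ofReal ((0 + 1 * x) ^ 2)) (by fun_prop)
      rw [lintegral_affine_sq_gaussianReal] at this
      simp only [zero_add, one_mul, Function.eval] at this
      rw [prior, this, Real.coe_toNNReal _ (by positivity)]
      simp
    simp_rw [this]
    exact hsum.tsum_ofReal_ne_top
  filter_upwards [ae_lt_top hm hint] with f hf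
  exact summable_sq_of_tsum_ne_top hf.ne

/-- Every sampling law with parameter in `ℓ₂` is absolutely continuous with respect to the marginal
law of the observation. -/
lemma sampleLaw_absolutelyContinuous_marginal {α : ℝ} (hα : 0 < α) {κ : ℕ → ℝ} {B : ℝ}
    (hκ : ∀ i, |κ i| ≤ B) {n : ℕ} (hn : 1 ≤ n) {f₀ : ℕ → ℝ} (hf₀ : Summable fun i => f₀ i ^ 2) :
    sampleLaw κ n f₀ ≪ sampleLaw κ n ∘ₘ prior α := by
  refine Measure.AbsolutelyContinuous.mk fun A hA hA0 => ?_
  rw [Measure.bind_apply hA (sampleLaw κ n).aemeasurable,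
    lintegral_eq_zero_iff ((sampleLaw κ n).measurable_coe hA)] at hA0
  -- One parameter in `ℓ₂` under which `A` is null suffices.
  obtain ⟨f, hfA, hf⟩ := (hA0.and (ae_prior_summable_sq hα)).exists
  refine sampleLaw_absolutelyContinuous hn ?_ hfA
  refine Summable.of_nonneg_of_le (fun i => sq_nonneg _) (fun i => ?_)
    ((hf₀.add hf).mul_left (2 * B ^ 2))
  have h1 : κ i ^ 2 ≤ B ^ 2 := sq_le_sq' (by linarith [(abs_le.1 (hκ i)).1]) (abs_le.1 (hκ i)).2
  have h2 : (f₀ i - f i) ^ 2 ≤ 2 * (f₀ i ^ 2 + f i ^ 2) := by nlinarith [sq_nonneg (f₀ i + f i)]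
  calc (κ i * (f₀ i - f i)) ^ 2 = κ i ^ 2 * (f₀ i - f i) ^ 2 := by ring
    _ ≤ B ^ 2 * (2 * (f₀ i ^ 2 + f i ^ 2)) := by gcongr
    _ = _ := by ring

/-! ### The conjugate posterior -/

/-- A pair of independent standard normal variables is invariant under rotations. -/
lemma gaussianReal_prod_map_rotation {a b : ℝ} (hab : a ^ 2 + b ^ 2 = 1) :
    ((gaussianReal 0 1).prod (gaussianReal 0 1)).map
        (fun q : ℝ × ℝ => (a * q.1 + b * q.2, a * q.2 - b * q.1)) =
      (gaussianReal 0 1).prod (gaussianReal 0 1) := by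
  obtain ⟨θ, h1, h2⟩ : ∃ θ : ℝ, Real.cos θ = a ∧ Real.sin θ = b := by
    have hz : ‖(⟨a, b⟩ : ℂ)‖ = 1 := by
      rw [Complex.norm_def, Complex.normSq_mk]
      rw [show a * a + b * b = 1 by linarith [hab], Real.sqrt_one]
    have hz0 : (⟨a, b⟩ : ℂ) ≠ 0 := fun h => by simp [h] at hz
    exact ⟨Complex.arg ⟨a, b⟩, by rw [Complex.cos_arg hz0, hz]; simp,
      by rw [Complex.sin_arg, hz]; simp⟩
  have := IsGaussian.map_rotation_eq_self (μ := gaussianReal 0 1) (by simp) θ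
  convert this using 2
  funext q
  simp [ContinuousLinearMap.rotation_apply, h1, h2]
  ring

lemma noise_prod_map_rotation {a b : ℕ → ℝ} (hab : ∀ i, a i ^ 2 + b i ^ 2 = 1) :
    (noise.prod noise).map (fun q => ((fun i => a i * q.1 i + b i * q.2 i,
        fun i => a i * q.2 i - b i * q.1 i) : (ℕ → ℝ) × (ℕ → ℝ))) = noise.prod noise := by
  unfold noise
  have hsplit := infinitePi_prod_map_split (fun _ : ℕ => gaussianReal 0 1)
    (fun _ : ℕ => gaussianReal 0 1)
  have hrot := Measure.infinitePi_map_pi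
    (fun _ : ℕ => (gaussianReal 0 1).prod (gaussianReal 0 1))
    (f := fun i (q : ℝ × ℝ) => (a i * q.1 + b i * q.2, a i * q.2 - b i * q.1))
    (fun i => by fun_prop)
  simp_rw [gaussianReal_prod_map_rotation (hab _)] at hrot
  conv_rhs => rw [← hsplit, ← hrot]
  rw [← hsplit, Measure.map_map (by fun_prop) (by fun_prop),
    Measure.map_map (by fun_prop) (by fun_prop)]
  rfl

/-- The kernel `y ↦ law of (c_i y_i + s_i W_i)_i` with `W` white noise. -/
noncomputable def affineKernel (c s : ℕ → ℝ) : Kernel (ℕ → ℝ) (ℕ → ℝ) where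
  toFun y := noise.map fun w i => c i * y i + s i * w i
  measurable' := by
    have h : (fun y : ℕ → ℝ => noise.map fun w i => c i * y i + s i * w i) =
        fun y => (noise.map (Prod.mk y)).map
          (fun q : (ℕ → ℝ) × (ℕ → ℝ) => fun i => c i * q.1 i + s i * q.2 i) := by
      funext y
      rw [Measure.map_map (by fun_prop) (by fun_prop)]
      rfl
    rw [h]
    exact (Measure.measurable_map _ (by fun_prop)).comp Measurable.map_prodMk_left

lemma affineKernel_apply (c s y : ℕ → ℝ) :
    affineKernel c s y = noise.map fun w i => c i * y i + s i * w i := rfl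

instance (c s : ℕ → ℝ) : IsMarkovKernel (affineKernel c s) where
  isProbabilityMeasure y := by
    rw [affineKernel_apply]
    exact Measure.isProbabilityMeasure_map (Measurable.aemeasurable (by fun_prop))

lemma sampleLaw_eq_affineKernel (κ : ℕ → ℝ) (n : ℕ) :
    sampleLaw κ n = affineKernel κ fun _ => 1 / √(n : ℝ) := rfl

/-- Both joint laws in the definition of a posterior have this form, so conjugacy reduces to
comparing two linear images of a pair of independent white noises. -/
lemma noise_map_compProd_affineKernel (c s r : ℕ → ℝ) :
    (noise.map fun x i => r i * x i) ⊗ₘ affineKernel c s =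
      (noise.prod noise).map (fun q => ((fun i => r i * q.1 i,
        fun i => c i * (r i * q.1 i) + s i * q.2 i) : (ℕ → ℝ) × (ℕ → ℝ))) := by
  have hr : Measurable fun (x : ℕ → ℝ) i => r i * x i := by fun_prop
  refine Measure.ext_of_lintegral _ fun g hg => ?_
  rw [Measure.lintegral_compProd hg, lintegral_map (Measurable.lintegral_kernel_prod_right' hg) hr,
    lintegral_map hg (by fun_prop), lintegral_prod _ (by fun_prop)]
  refine lintegral_congr fun x => ?_
  rw [affineKernel_apply, lintegral_map (by fun_prop) (by fun_prop)]

lemma prior_eq_noise_map (α : ℝ) :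
    prior α = noise.map fun x i => √(((i : ℕ) + 1 : ℝ) ^ (-1 - 2 * α)) * x i := by
  unfold noise
  rw [Measure.infinitePi_map_pi _ (f := fun i x => √(((i : ℕ) + 1 : ℝ) ^ (-1 - 2 * α)) * x)
    (fun i => by fun_prop), prior]
  congr 1
  funext i
  rw [gaussianReal_map_const_mul]
  congr 1
  · simp
  · ext
    have : (0 : ℝ) ≤ ((i : ℕ) + 1 : ℝ) ^ (-1 - 2 * α) := by positivity
    simp [Real.sq_sqrt this, this]

/-- Conjugacy: the posterior mean is `c_i Y_i` and the posterior standard deviation `s_i`. -/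
lemma isPosterior_affineKernel {α : ℝ} {κ : ℕ → ℝ} {n : ℕ} (hn : 1 ≤ n) {c s : ℕ → ℝ}
    (hc : ∀ i : ℕ, c i = κ i * ((i : ℝ) + 1) ^ (-1 - 2 * α) /
      (κ i ^ 2 * ((i : ℝ) + 1) ^ (-1 - 2 * α) + 1 / n))
    (hs : ∀ i : ℕ, s i = -√(((i : ℝ) + 1) ^ (-1 - 2 * α)) * (1 / √(n : ℝ)) /
      √(κ i ^ 2 * ((i : ℝ) + 1) ^ (-1 - 2 * α) + 1 / n)) :
    IsPosterior (prior α) (sampleLaw κ n) (affineKernel c s) := by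
  have hnpos : (0 : ℝ) < n := by exact_mod_cast hn
  set σ : ℕ → ℝ := fun i => √(((i : ℝ) + 1) ^ (-1 - 2 * α)) with hσ
  have hσsq : ∀ i : ℕ, ((i : ℝ) + 1) ^ (-1 - 2 * α) = σ i ^ 2 := fun i =>
    (Real.sq_sqrt (by positivity)).symm
  set e : ℝ := 1 / √(n : ℝ) with he
  have hesq : (1 : ℝ) / n = e ^ 2 := by rw [he, div_pow, Real.sq_sqrt hnpos.le, one_pow]
  have hepos : 0 < e := by positivity
  -- The marginal standard deviation of `Y i`.
  set v : ℕ → ℝ := fun i => √(κ i ^ 2 * σ i ^ 2 + e ^ 2) with hv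
  have hvpos : ∀ i, 0 < v i := fun i => Real.sqrt_pos.2 (by positivity)
  have hvsq : ∀ i, v i ^ 2 = κ i ^ 2 * σ i ^ 2 + e ^ 2 := fun i => Real.sq_sqrt (by positivity)
  have hc' : ∀ i, c i = κ i * σ i ^ 2 / v i ^ 2 := fun i => by rw [hc, hvsq, hσsq, hesq]
  have hs' : ∀ i, s i = -σ i * e / v i := fun i => by
    rw [hs, hesq, hσsq, Real.sqrt_sq (Real.sqrt_nonneg _)]
  have hab : ∀ i, (κ i * σ i / v i) ^ 2 + (e / v i) ^ 2 = 1 := fun i => by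
    have := (hvpos i).ne'
    field_simp
    rw [hvsq]
  -- With `f = σ X` and `Y = κ σ X + e Z`, this rotation sends `(X, Z)` to `(U, W)` with `U = Y / v`
  -- and `W` independent of it. Inverting, `X = (κσ/v) U - (e/v) W`, so `f = c Y + s W`; this is the
  -- source of the minus sign in `s`.
  have hrot := noise_prod_map_rotation hab
  have hjoint : prior α ⊗ₘ sampleLaw κ n =
      (noise.prod noise).map (fun q => ((fun i => σ i * q.1 i,
        fun i => κ i * (σ i * q.1 i) + e * q.2 i) : (ℕ → ℝ) × (ℕ → ℝ))) := by
    rw [prior_eq_noise_map, sampleLaw_eq_affineKernel]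
    exact noise_map_compProd_affineKernel κ (fun _ => e) σ
  have hmarg : sampleLaw κ n ∘ₘ prior α = noise.map fun x i => v i * x i := by
    rw [← Measure.snd_compProd, hjoint, Measure.snd, Measure.map_map measurable_snd (by fun_prop)]
    conv_rhs => rw [← Measure.fst_prod (μ := noise) (ν := noise), ← hrot, Measure.fst,
      Measure.map_map measurable_fst (by fun_prop), Measure.map_map (by fun_prop) (by fun_prop)]
    congr 1
    funext q i
    have := (hvpos i).ne'
    simp only [Function.comp]
    field_simp
  unfold IsPosterior
  rw [hmarg, noise_map_compProd_affineKernel, hjoint, Measure.map_map measurable_swap (by fun_prop)]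
  conv_lhs => rw [← hrot, Measure.map_map (by fun_prop) (by fun_prop)]
  congr 1
  funext q
  refine Prod.ext ?_ ?_
  · funext i
    have := (hvpos i).ne'
    simp only [Function.comp, Prod.swap]
    field_simp
  · funext i
    have := (hvpos i).ne'
    simp only [Function.comp, Prod.swap, hc', hs']
    have h2 := hvsq i
    field_simp
    rw [h2]
    ring

/-! ### The posterior risk -/

/-- The bias–variance decomposition: the cross terms vanish because the posterior noise and the
observation noise are centred. -/
lemma lintegral_affineKernel_sq (c s κ f₀ : ℕ → ℝ) (n i : ℕ) :
    ∫⁻ Y, ∫⁻ f, ENNReal.ofReal ((f i - f₀ i) ^ 2) ∂(affineKernel c s Y) ∂(sampleLaw κ n f₀) =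
      ENNReal.ofReal (((c i * κ i - 1) * f₀ i) ^ 2 + (c i * (1 / √(n : ℝ))) ^ 2 + s i ^ 2) := by
  have h1 : ∀ Y, ∫⁻ f, ENNReal.ofReal ((f i - f₀ i) ^ 2) ∂(affineKernel c s Y) =
      ENNReal.ofReal ((c i * Y i - f₀ i) ^ 2) + ENNReal.ofReal (s i ^ 2) := fun Y => by
    rw [affineKernel_apply, lintegral_map (by fun_prop) (by fun_prop),
      ← ENNReal.ofReal_add (sq_nonneg _) (sq_nonneg _), ← lintegral_noise_affine_sq _ _ i]
    refine lintegral_congr fun w => ?_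
    ring_nf
  simp_rw [h1]
  rw [lintegral_add_right _ measurable_const, lintegral_const, measure_univ, mul_one,
    sampleLaw_apply, lintegral_map (by fun_prop) (measurable_observe_right κ n f₀),
    ENNReal.ofReal_add (by positivity) (by positivity)]
  congr 1
  rw [← lintegral_noise_affine_sq _ _ i]
  refine lintegral_congr fun z => ?_
  simp only [observe]
  ring_nf

lemma lintegral_affineKernel_tsum_sq (c s κ f₀ : ℕ → ℝ) (n : ℕ) :
    ∫⁻ Y, ∫⁻ f, ∑' i, ENNReal.ofReal ((f i - f₀ i) ^ 2) ∂(affineKernel c s Y)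
        ∂(sampleLaw κ n f₀) =
      ∑' i, ENNReal.ofReal
        (((c i * κ i - 1) * f₀ i) ^ 2 + (c i * (1 / √(n : ℝ))) ^ 2 + s i ^ 2) := by
  have hm : ∀ i, Measurable fun f : ℕ → ℝ => ENNReal.ofReal ((f i - f₀ i) ^ 2) := fun i => by
    fun_prop
  simp_rw [lintegral_tsum fun i => (hm i).aemeasurable]
  rw [lintegral_tsum fun i => ((hm i).lintegral_kernel).aemeasurable]
  simp_rw [lintegral_affineKernel_sq]

lemma ell2Norm_sq (f : ℕ → ℝ) : ell2Norm f ^ 2 = ∑' i, ENNReal.ofReal (f i ^ 2) := by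
  rw [ell2Norm, ← ENNReal.rpow_two, ← ENNReal.rpow_mul]
  norm_num

/-- Markov's inequality for the squared `ℓ₂`-distance. -/
lemma measure_le_ell2Norm_sub (ρ : Measure (ℕ → ℝ)) (f₀ : ℕ → ℝ) {r : ℝ} (hr : 0 < r) :
    ρ {f | ENNReal.ofReal r ≤ ell2Norm (f - f₀)} ≤
      (∫⁻ f, ∑' i, ENNReal.ofReal ((f i - f₀ i) ^ 2) ∂ρ) / ENNReal.ofReal (r ^ 2) := by
  have hm : Measurable fun f : ℕ → ℝ => ∑' i, ENNReal.ofReal ((f i - f₀ i) ^ 2) :=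
    Measurable.tsum fun i => by fun_prop
  refine (measure_mono fun f hf => ?_).trans (meas_ge_le_lintegral_div hm.aemeasurable
    (by simpa using hr.ne') ENNReal.ofReal_ne_top)
  have := ell2Norm_sq (f - f₀)
  simp only [Pi.sub_apply] at this
  simp only [Set.mem_ofPred_eq] at hf ⊢
  rw [← this, ENNReal.ofReal_pow hr.le]
  gcongr

/-! ### Rates -/

lemma rpow_le_one_add {x θ : ℝ} (hx : 0 ≤ x) (h0 : 0 ≤ θ) (h1 : θ ≤ 1) : x ^ θ ≤ 1 + x := by
  rcases le_total x 1 with h | h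
  · linarith [Real.rpow_le_one hx h h0]
  · have := Real.rpow_le_rpow_of_exponent_le h h1
    rw [Real.rpow_one] at this
    linarith

/-- The bias at frequency `j` relative to the weight of the Sobolev norm. -/
lemma inv_one_add_sq_le {n j q β γ : ℝ} (hn : 1 ≤ n) (hj : 1 ≤ j) (hq : 0 < q) (hγ : 0 ≤ γ)
    (hγβ : γ ≤ β) (hγq : γ ≤ q) :
    1 / (1 + n * j ^ (-q)) ^ 2 ≤ n ^ (-(2 * γ) / q) * j ^ (2 * β) := by
  have hn0 : 0 < n := by linarith
  have hj0 : 0 < j := by linarith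
  -- The exponent `γ / q` turns `j ^ (-q)` into `j ^ (-γ)`, and `γ ≤ q` keeps it at most 1. Since `j
  -- ≥ 1`, `j ^ (-γ)` may then be lowered to `j ^ (-β)`.
  have h1 : (n * j ^ (-q)) ^ (γ / q) ≤ 1 + n * j ^ (-q) :=
    rpow_le_one_add (by positivity) (by positivity) ((div_le_one hq).2 hγq)
  have h2 : (n * j ^ (-q)) ^ (γ / q) = n ^ (γ / q) * j ^ (-γ) := by
    rw [Real.mul_rpow hn0.le (by positivity), ← Real.rpow_mul hj0.le]
    congr 2
    field_simp
  rw [h2] at h1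
  have h3 : n ^ (γ / q) * j ^ (-β) ≤ 1 + n * j ^ (-q) := le_trans (by gcongr) h1
  have h4 : (n ^ (γ / q) * j ^ (-β)) ^ 2 ≤ (1 + n * j ^ (-q)) ^ 2 := by gcongr
  have h5 : (n ^ (γ / q) * j ^ (-β)) ^ 2 * (n ^ (-(2 * γ) / q) * j ^ (2 * β)) = 1 := by
    have e1 : (n ^ (γ / q)) ^ 2 * n ^ (-(2 * γ) / q) = 1 := by
      rw [← Real.rpow_natCast, ← Real.rpow_mul hn0.le, ← Real.rpow_add hn0]
      convert Real.rpow_zero n using 2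
      push_cast
      ring
    have e2 : (j ^ (-β)) ^ 2 * j ^ (2 * β) = 1 := by
      rw [← Real.rpow_natCast, ← Real.rpow_mul hj0.le, ← Real.rpow_add hj0]
      convert Real.rpow_zero j using 2
      push_cast
      ring
    calc _ = ((n ^ (γ / q)) ^ 2 * n ^ (-(2 * γ) / q)) * ((j ^ (-β)) ^ 2 * j ^ (2 * β)) := by ring
      _ = 1 := by rw [e1, e2, one_mul]
  rw [div_le_iff₀ (by positivity), mul_comm]
  exact h5.symm.trans_le (by gcongr)

/-- Comparison of `y^{-1-a}` with a telescoping difference. -/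
lemma rpow_neg_one_sub_le {a y : ℝ} (ha : 0 < a) (hy : 1 < y) :
    y ^ (-1 - a) ≤ a⁻¹ * ((y - 1) ^ (-a) - y ^ (-a)) := by
  have hy0 : 0 < y := by linarith
  have hz : 0 < 1 - y⁻¹ := by linarith [inv_lt_one_of_one_lt₀ hy]
  have h1 : (y - 1) ^ (-a) = y ^ (-a) * (1 - y⁻¹) ^ (-a) := by
    rw [← Real.mul_rpow hy0.le hz.le]
    congr 1
    field_simp
  -- A Bernoulli inequality with negative exponent, from `exp u ≥ 1 + u` and `log u ≤ u - 1`.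
  have h2 : 1 + a * y⁻¹ ≤ (1 - y⁻¹) ^ (-a) := by
    rw [Real.rpow_def_of_pos hz]
    have hlog : Real.log (1 - y⁻¹) ≤ -y⁻¹ := by linarith [Real.log_le_sub_one_of_pos hz]
    have := Real.add_one_le_exp (Real.log (1 - y⁻¹) * -a)
    nlinarith
  have h3 : y ^ (-1 - a) = y ^ (-a) * y⁻¹ := by
    rw [← Real.rpow_neg_one, ← Real.rpow_add hy0]
    congr 1
    ring
  have h4 : y ^ (-a) * (1 + a * y⁻¹) ≤ y ^ (-a) * (1 - y⁻¹) ^ (-a) := by gcongr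
  rw [h1, h3, le_inv_mul_iff₀ ha]
  linarith

lemma sum_range_tail_le {a : ℝ} (ha : 0 < a) {m : ℕ} (hm : 1 ≤ m) (N : ℕ) :
    ∑ k ∈ Finset.range N, (((k + m : ℕ) : ℝ) + 1) ^ (-1 - a) ≤ a⁻¹ * (m : ℝ) ^ (-a) := by
  have hm0 : (1 : ℝ) ≤ m := by exact_mod_cast hm
  calc ∑ k ∈ Finset.range N, (((k + m : ℕ) : ℝ) + 1) ^ (-1 - a)
      ≤ ∑ k ∈ Finset.range N,
          a⁻¹ * (((k + m : ℕ) : ℝ) ^ (-a) - ((k + 1 + m : ℕ) : ℝ) ^ (-a)) := by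
        refine Finset.sum_le_sum fun k _ => ?_
        have hk : (0 : ℝ) ≤ k := k.cast_nonneg
        have := rpow_neg_one_sub_le ha (y := ((k + m : ℕ) : ℝ) + 1) (by push_cast; linarith)
        rw [add_sub_cancel_right] at this
        refine this.trans_eq ?_
        congr 3
        push_cast
        ring
    _ = a⁻¹ * ((m : ℝ) ^ (-a) - ((N + m : ℕ) : ℝ) ^ (-a)) := by
        rw [← Finset.mul_sum, Finset.sum_range_sub' fun k : ℕ => ((k + m : ℕ) : ℝ) ^ (-a)]
        simp
    _ ≤ _ := by
        have : (0 : ℝ) ≤ ((N + m : ℕ) : ℝ) ^ (-a) := by positivity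
        gcongr
        linarith

/-- The order of the posterior variance. -/
lemma tsum_variance_le {α p : ℝ} (hα : 0 < α) (hp : 0 ≤ p) {n : ℕ} (hn : 1 ≤ n) :
    ∑' i : ℕ, ENNReal.ofReal (((i : ℝ) + 1) ^ (-1 - 2 * α) /
        (1 + n * ((i : ℝ) + 1) ^ (-(1 + 2 * α + 2 * p)))) ≤
      ENNReal.ofReal ((1 + (2 * α)⁻¹ * 2 ^ (2 * α)) *
        (n : ℝ) ^ (-(2 * α) / (1 + 2 * α + 2 * p))) := by
  set q := 1 + 2 * α + 2 * p with hq
  have hq0 : 0 < q := by positivity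
  have hn1 : (1 : ℝ) ≤ n := by exact_mod_cast hn
  have hn0 : (0 : ℝ) < n := by linarith
  -- The frequency at which `n j^{-q} = 1`: below it the data dominate the prior, above it the prior
  -- dominates.
  set T : ℝ := (n : ℝ) ^ (1 / q) with hT
  have hT1 : 1 ≤ T := Real.one_le_rpow hn1 (by positivity)
  have hT0 : 0 < T := by linarith
  have hTq : T ^ q = n := by
    rw [hT, ← Real.rpow_mul hn0.le, one_div_mul_cancel hq0.ne', Real.rpow_one]
  have hTα : (n : ℝ) ^ (-(2 * α) / q) = T ^ (-(2 * α)) := by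
    rw [hT, ← Real.rpow_mul hn0.le]
    congr 1
    ring
  set m := ⌊T⌋₊ with hm
  have hm1 : 1 ≤ m := Nat.one_le_floor_iff T |>.2 hT1
  have hmT : (m : ℝ) ≤ T := Nat.floor_le hT0.le
  have hTm : T / 2 ≤ m := by
    have h1 : T < m + 1 := Nat.lt_floor_add_one T
    have h2 : (1 : ℝ) ≤ m := by exact_mod_cast hm1
    linarith
  set w : ℕ → ℝ := fun i => ((i : ℝ) + 1) ^ (-1 - 2 * α) / (1 + n * ((i : ℝ) + 1) ^ (-q)) with hw
  have hw0 : ∀ i, 0 ≤ w i := fun i => by positivity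
  -- Without the 1 in the denominator each term is `j ^ (2p) / n ≤ T ^ (2p) / n`. There are at most
  -- `T` terms, and `T ^ (1 + 2p) / n = T ^ (-2α)` since `n = T ^ q`.
  have hhead : ∑ i ∈ Finset.range m, w i ≤ T ^ (-(2 * α)) := by
    calc ∑ i ∈ Finset.range m, w i ≤ ∑ i ∈ Finset.range m, T ^ (2 * p) / n := by
          refine Finset.sum_le_sum fun i hi => ?_
          have hi1 : (i : ℝ) + 1 ≤ T := by
            have : (i : ℝ) + 1 ≤ m := by exact_mod_cast Finset.mem_range.1 hi
            linarith
          have hj : (0 : ℝ) < (i : ℝ) + 1 := by positivity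
          calc w i ≤ ((i : ℝ) + 1) ^ (-1 - 2 * α) / (n * ((i : ℝ) + 1) ^ (-q)) := by
                simp only [hw]
                gcongr
                linarith
            _ = ((i : ℝ) + 1) ^ (2 * p) / n := by
                have : ((i : ℝ) + 1) ^ (-1 - 2 * α) =
                    ((i : ℝ) + 1) ^ (2 * p) * ((i : ℝ) + 1) ^ (-q) := by
                  rw [← Real.rpow_add hj]
                  congr 1
                  rw [hq]; ring
                rw [this]
                field_simp
            _ ≤ T ^ (2 * p) / n := by gcongr
      _ = m * (T ^ (2 * p) / n) := by simp
      _ ≤ T * (T ^ (2 * p) / n) := by gcongr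
      _ = T ^ (-(2 * α)) := by
          have h1 : T * T ^ (2 * p) = T ^ (-(2 * α)) * T ^ q := by
            rw [← Real.rpow_one_add' hT0.le (by positivity), ← Real.rpow_add hT0]
            congr 1
            rw [hq]; ring
          rw [← mul_div_assoc, h1, hTq]
          field_simp
  -- Here the denominator is bounded below by 1, leaving the tail of the prior variances. The factor
  -- `2 ^ (2α)` pays for replacing `m` by `T / 2`.
  have htail : ∀ N, ∑ k ∈ Finset.range N, w (k + m) ≤ (2 * α)⁻¹ * 2 ^ (2 * α) * T ^ (-(2 * α)) := by
    intro N
    calc ∑ k ∈ Finset.range N, w (k + m)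
        ≤ ∑ k ∈ Finset.range N, (((k + m : ℕ) : ℝ) + 1) ^ (-1 - 2 * α) := by
          refine Finset.sum_le_sum fun k _ => div_le_self (by positivity) ?_
          have : 0 ≤ (n : ℝ) * (((k + m : ℕ) : ℝ) + 1) ^ (-q) := by positivity
          linarith
      _ ≤ (2 * α)⁻¹ * (m : ℝ) ^ (-(2 * α)) := sum_range_tail_le (by positivity) hm1 N
      _ ≤ (2 * α)⁻¹ * (T / 2) ^ (-(2 * α)) := by
          gcongr ?_ * ?_
          exact Real.rpow_le_rpow_of_nonpos (by positivity) hTm (neg_nonpos.2 (by positivity))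
      _ = _ := by
          rw [div_eq_mul_inv, Real.mul_rpow hT0.le (by norm_num), Real.inv_rpow (by norm_num),
            Real.rpow_neg (by norm_num : (0 : ℝ) ≤ 2), inv_inv]
          ring
  rw [hTα, add_mul, one_mul, ENNReal.ofReal_add (by positivity) (by positivity),
    ← ENNReal.summable.sum_add_tsum_nat_add' (k := m)]
  gcongr
  · rw [← ENNReal.ofReal_sum_of_nonneg fun i _ => hw0 i]
    exact ENNReal.ofReal_le_ofReal hhead
  · refine ENNReal.tsum_le_of_sum_range_le fun N => ?_
    rw [← ENNReal.ofReal_sum_of_nonneg fun i _ => hw0 (i + m)]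
    exact ENNReal.ofReal_le_ofReal (htail N)

/-! ### Combining bias and variance -/

/-- Squared bias, sampling variance and posterior variance in one coordinate with prior variance
`l`. -/
lemma coordinate_risk_le {n k l C t f : ℝ} (hn : 0 < n) (hl : 0 ≤ l) (hC : 1 ≤ C) (ht : 0 ≤ t)
    (hk : C⁻¹ ^ 2 * t ≤ k ^ 2 * l) :
    ((k * l / (k ^ 2 * l + 1 / n) * k - 1) * f) ^ 2 +
        (k * l / (k ^ 2 * l + 1 / n) * (1 / √n)) ^ 2 +
        (-√l * (1 / √n) / √(k ^ 2 * l + 1 / n)) ^ 2 ≤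
      C ^ 4 * (f ^ 2 * (1 / (1 + n * t) ^ 2)) + 2 * C ^ 2 * (l / (1 + n * t)) := by
  have hC0 : 0 < C := by linarith
  -- The signal-to-noise ratio of the coordinate. In terms of it the bias factor is `-1 / (1 + x)`,
  -- the sampling variance `l x / (1 + x)²` and the posterior variance `l / (1 + x)`.
  set x := n * (k ^ 2 * l) with hx
  have hx0 : 0 ≤ x := by positivity
  have hxt : 1 + n * t ≤ C ^ 2 * (1 + x) := by
    have h1 : t ≤ C ^ 2 * (k ^ 2 * l) := by
      have := mul_le_mul_of_nonneg_left hk (sq_nonneg C)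
      rwa [← mul_assoc, ← mul_pow, mul_inv_cancel₀ hC0.ne', one_pow, one_mul] at this
    have h2 := mul_le_mul_of_nonneg_left h1 hn.le
    have h3 : 1 ≤ C ^ 2 := one_le_pow₀ hC
    calc 1 + n * t ≤ C ^ 2 + n * (C ^ 2 * (k ^ 2 * l)) := add_le_add h3 h2
      _ = _ := by rw [hx]; ring
  have hden : k ^ 2 * l + 1 / n = (1 + x) / n := by rw [hx]; field_simp; ring
  have e1 : k * l / (k ^ 2 * l + 1 / n) * k - 1 = -(1 / (1 + x)) := by
    rw [hden, hx]; field_simp; ring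
  have e2 : (k * l / (k ^ 2 * l + 1 / n) * (1 / √n)) ^ 2 = l * x / (1 + x) ^ 2 := by
    rw [hden, mul_pow, div_pow 1, Real.sq_sqrt hn.le, hx]; field_simp
  have e3 : (-√l * (1 / √n) / √(k ^ 2 * l + 1 / n)) ^ 2 = l / (1 + x) := by
    rw [div_pow, mul_pow, neg_sq, div_pow, Real.sq_sqrt hl, Real.sq_sqrt hn.le, hden,
      Real.sq_sqrt (by positivity)]
    field_simp
  rw [e1, e2, e3]
  have hnt : 0 < 1 + n * t := by positivity
  have i1 : 1 / (1 + x) ≤ C ^ 2 * (1 / (1 + n * t)) := by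
    rw [mul_one_div, div_le_div_iff₀ (by positivity) hnt]
    linarith
  have i2 : (1 / (1 + x)) ^ 2 ≤ (C ^ 2 * (1 / (1 + n * t))) ^ 2 := by gcongr
  -- The sampling variance never exceeds the posterior variance, whence the factor 2 in the bound.
  have i3 : l * x / (1 + x) ^ 2 ≤ l * (1 / (1 + x)) := by
    rw [mul_div_assoc]
    refine mul_le_mul_of_nonneg_left ?_ hl
    rw [div_le_div_iff₀ (by positivity) (by positivity)]
    nlinarith
  have i4 : l * (1 / (1 + x)) ≤ l * (C ^ 2 * (1 / (1 + n * t))) := by gcongr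
  have i5 : f ^ 2 * (1 / (1 + x)) ^ 2 ≤ f ^ 2 * (C ^ 2 * (1 / (1 + n * t))) ^ 2 := by gcongr
  calc (-(1 / (1 + x)) * f) ^ 2 + l * x / (1 + x) ^ 2 + l / (1 + x)
      = f ^ 2 * (1 / (1 + x)) ^ 2 + l * x / (1 + x) ^ 2 + l * (1 / (1 + x)) := by ring
    _ ≤ f ^ 2 * (C ^ 2 * (1 / (1 + n * t))) ^ 2 + l * (C ^ 2 * (1 / (1 + n * t))) +
          l * (C ^ 2 * (1 / (1 + n * t))) := by linarith
    _ = _ := by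
        rw [mul_pow, one_div_pow]
        ring

lemma tsum_le_of_mem_sobolevBall {β R : ℝ} (hR : 0 < R) {f : ℕ → ℝ} (hf : f ∈ sobolevBall β R) :
    ∑' i : ℕ, ENNReal.ofReal (f i ^ 2 * ((i : ℝ) + 1) ^ (2 * β)) ≤ ENNReal.ofReal (R ^ 2) := by
  have h := ENNReal.rpow_le_rpow hf.2 (z := 2) (by norm_num)
  rw [sobolevNorm, ← ENNReal.rpow_mul, ENNReal.rpow_two, ← ENNReal.ofReal_pow hR.le] at h
  simpa using h

lemma summable_sq_of_mem_sobolevBall {β R : ℝ} {f : ℕ → ℝ} (hf : f ∈ sobolevBall β R) :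
    Summable fun i => f i ^ 2 := by
  refine summable_sq_of_tsum_ne_top ?_
  rw [← ell2Norm_sq]
  exact ENNReal.pow_ne_top hf.1.1.ne

/-- The integrated posterior risk is of the order of the squared rate on the Sobolev ball. -/
lemma tsum_risk_le {p C α β R : ℝ} (hp : 0 ≤ p) (hC : 1 ≤ C) (hα : 0 < α) (hβ : 0 < β)
    (hR : 0 < R) {κ : ℕ → ℝ} (hκ : ∀ i : ℕ, C⁻¹ * ((i : ℝ) + 1) ^ (-p) ≤ κ i) {n : ℕ}
    (hn : 1 ≤ n) {f₀ : ℕ → ℝ} (hf₀ : f₀ ∈ sobolevBall β R) {c s : ℕ → ℝ}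
    (hc : ∀ i : ℕ, c i = κ i * ((i : ℝ) + 1) ^ (-1 - 2 * α) /
      (κ i ^ 2 * ((i : ℝ) + 1) ^ (-1 - 2 * α) + 1 / n))
    (hs : ∀ i : ℕ, s i = -√(((i : ℝ) + 1) ^ (-1 - 2 * α)) * (1 / √(n : ℝ)) /
      √(κ i ^ 2 * ((i : ℝ) + 1) ^ (-1 - 2 * α) + 1 / n)) :
    ∑' i, ENNReal.ofReal
        (((c i * κ i - 1) * f₀ i) ^ 2 + (c i * (1 / √(n : ℝ))) ^ 2 + s i ^ 2) ≤
      ENNReal.ofReal ((C ^ 4 * R ^ 2 + 2 * C ^ 2 * (1 + (2 * α)⁻¹ * 2 ^ (2 * α))) *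
        (n : ℝ) ^ (-(2 * min α β) / (1 + 2 * α + 2 * p))) := by
  set q := 1 + 2 * α + 2 * p with hq
  have hq0 : 0 < q := by positivity
  have hn1 : (1 : ℝ) ≤ n := by exact_mod_cast hn
  have hn0 : (0 : ℝ) < n := by linarith
  have hC0 : 0 < C := by linarith
  set x : ℝ := (n : ℝ) ^ (-(2 * min α β) / q) with hx
  have hx0 : 0 < x := by positivity
  have hterm : ∀ i : ℕ, ENNReal.ofReal
      (((c i * κ i - 1) * f₀ i) ^ 2 + (c i * (1 / √(n : ℝ))) ^ 2 + s i ^ 2) ≤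
      ENNReal.ofReal (C ^ 4 * x) * ENNReal.ofReal (f₀ i ^ 2 * ((i : ℝ) + 1) ^ (2 * β)) +
      ENNReal.ofReal (2 * C ^ 2) * ENNReal.ofReal (((i : ℝ) + 1) ^ (-1 - 2 * α) /
        (1 + n * ((i : ℝ) + 1) ^ (-q))) := fun i => by
    have hj : (0 : ℝ) < (i : ℝ) + 1 := by positivity
    have hj1 : (1 : ℝ) ≤ (i : ℝ) + 1 := by linarith [(i.cast_nonneg : (0 : ℝ) ≤ i)]
    rw [← ENNReal.ofReal_mul (by positivity), ← ENNReal.ofReal_mul (by positivity),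
      ← ENNReal.ofReal_add (by positivity) (by positivity)]
    refine ENNReal.ofReal_le_ofReal ?_
    have hk : C⁻¹ ^ 2 * ((i : ℝ) + 1) ^ (-q) ≤ κ i ^ 2 * ((i : ℝ) + 1) ^ (-1 - 2 * α) := by
      have h1 : (C⁻¹ * ((i : ℝ) + 1) ^ (-p)) ^ 2 ≤ κ i ^ 2 :=
        pow_le_pow_left₀ (by positivity) (hκ i) 2
      have h2 : ((i : ℝ) + 1) ^ (-q) =
          (((i : ℝ) + 1) ^ (-p)) ^ 2 * ((i : ℝ) + 1) ^ (-1 - 2 * α) := by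
        rw [← Real.rpow_natCast, ← Real.rpow_mul hj.le, ← Real.rpow_add hj]
        congr 1
        rw [hq]
        push_cast
        ring
      rw [h2, ← mul_assoc, ← mul_pow]
      gcongr
    have h := coordinate_risk_le (f := f₀ i) hn0
      (by positivity : (0 : ℝ) ≤ ((i : ℝ) + 1) ^ (-1 - 2 * α)) hC
      (by positivity : (0 : ℝ) ≤ ((i : ℝ) + 1) ^ (-q)) hk
    rw [← hc i, ← hs i] at h
    refine h.trans ?_
    -- Taking `γ = min α β` gives the bias the target rate; the constraint `γ ≤ q` is automatic
    -- because `α ≤ q`.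
    have hb := inv_one_add_sq_le hn1 hj1 hq0 (le_min hα.le hβ.le) (min_le_right α β)
      ((min_le_left α β).trans (by rw [hq]; linarith) : min α β ≤ q)
    calc _ ≤ C ^ 4 * (f₀ i ^ 2 * (x * ((i : ℝ) + 1) ^ (2 * β))) + 2 * C ^ 2 *
          (((i : ℝ) + 1) ^ (-1 - 2 * α) / (1 + n * ((i : ℝ) + 1) ^ (-q))) := by gcongr
      _ = _ := by ring
  refine (ENNReal.tsum_le_tsum hterm).trans ?_
  rw [ENNReal.tsum_add, ENNReal.tsum_mul_left, ENNReal.tsum_mul_left]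
  have hvar : (n : ℝ) ^ (-(2 * α) / q) ≤ x := by
    refine Real.rpow_le_rpow_of_exponent_le hn1 ?_
    gcongr
    exact min_le_left α β
  calc _ ≤ ENNReal.ofReal (C ^ 4 * x) * ENNReal.ofReal (R ^ 2) + ENNReal.ofReal (2 * C ^ 2) *
        ENNReal.ofReal ((1 + (2 * α)⁻¹ * 2 ^ (2 * α)) * x) := by
        gcongr
        · exact tsum_le_of_mem_sobolevBall hR hf₀
        · exact (tsum_variance_le hα hp hn).trans (ENNReal.ofReal_le_ofReal (by gcongr))
    _ = _ := by
        rw [← ENNReal.ofReal_mul (by positivity), ← ENNReal.ofReal_mul (by positivity),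
          ← ENNReal.ofReal_add (by positivity) (by positivity)]
        congr 1
        ring

/-! ### From risk to posterior mass -/

/-- A bound on the expected posterior mass outside a ball, for every version of the posterior. -/
lemma lintegral_posterior_le {p C α β R : ℝ} (hp : 0 ≤ p) (hC : 1 ≤ C) (hα : 0 < α) (hβ : 0 < β)
    (hR : 0 < R) {κ : ℕ → ℝ}
    (hκ : ∀ i : ℕ, C⁻¹ * ((i : ℝ) + 1) ^ (-p) ≤ κ i ∧ κ i ≤ C * ((i : ℝ) + 1) ^ (-p)) {n : ℕ}
    (hn : 1 ≤ n) (post : Kernel (ℕ → ℝ) (ℕ → ℝ)) [IsMarkovKernel post]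
    (hpost : IsPosterior (prior α) (sampleLaw κ n) post)
    {f₀ : ℕ → ℝ} (hf₀ : f₀ ∈ sobolevBall β R) {r : ℝ} (hr : 0 < r) :
    ∫⁻ Y, post Y {f | ENNReal.ofReal r ≤ ell2Norm (f - f₀)} ∂(sampleLaw κ n f₀) ≤
      ENNReal.ofReal ((C ^ 4 * R ^ 2 + 2 * C ^ 2 * (1 + (2 * α)⁻¹ * 2 ^ (2 * α))) *
        (n : ℝ) ^ (-(2 * min α β) / (1 + 2 * α + 2 * p))) / ENNReal.ofReal (r ^ 2) := by
  have hC0 : 0 < C := by linarith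
  set c : ℕ → ℝ := fun i => κ i * ((i : ℝ) + 1) ^ (-1 - 2 * α) /
    (κ i ^ 2 * ((i : ℝ) + 1) ^ (-1 - 2 * α) + 1 / n)
  set s : ℕ → ℝ := fun i => -√(((i : ℝ) + 1) ^ (-1 - 2 * α)) * (1 / √(n : ℝ)) /
    √(κ i ^ 2 * ((i : ℝ) + 1) ^ (-1 - 2 * α) + 1 / n)
  have hconj : IsPosterior (prior α) (sampleLaw κ n) (affineKernel c s) :=
    isPosterior_affineKernel hn (fun _ => rfl) (fun _ => rfl)
  -- Disintegrations are unique only up to marginal null sets; `hac` below carries this equality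
  -- over to the sampling law at `f₀`.
  have hae : post =ᵐ[sampleLaw κ n ∘ₘ prior α] affineKernel c s :=
    Kernel.ae_eq_of_compProd_eq (Eq.trans hpost (Eq.symm hconj))
  have hκC : ∀ i, |κ i| ≤ C := fun i => by
    have h0 : 0 ≤ κ i := le_trans (by positivity) (hκ i).1
    rw [abs_of_nonneg h0]
    refine (hκ i).2.trans (mul_le_of_le_one_right hC0.le ?_)
    exact Real.rpow_le_one_of_one_le_of_nonpos (by linarith [(i.cast_nonneg : (0 : ℝ) ≤ i)])
      (by linarith)
  have hac := sampleLaw_absolutelyContinuous_marginal hα hκC hn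
    (summable_sq_of_mem_sobolevBall hf₀)
  calc ∫⁻ Y, post Y {f | ENNReal.ofReal r ≤ ell2Norm (f - f₀)} ∂(sampleLaw κ n f₀)
      = ∫⁻ Y, affineKernel c s Y {f | ENNReal.ofReal r ≤ ell2Norm (f - f₀)}
          ∂(sampleLaw κ n f₀) := by
        refine lintegral_congr_ae ?_
        filter_upwards [hac.ae_le hae] with Y hY
        rw [hY]
    _ ≤ ∫⁻ Y, (∫⁻ f, ∑' i, ENNReal.ofReal ((f i - f₀ i) ^ 2) ∂(affineKernel c s Y)) *
          (ENNReal.ofReal (r ^ 2))⁻¹ ∂(sampleLaw κ n f₀) := by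
        refine lintegral_mono fun Y => ?_
        rw [← div_eq_mul_inv]
        exact measure_le_ell2Norm_sub _ f₀ hr
    _ ≤ _ := by
        have hr2 : ENNReal.ofReal (r ^ 2) ≠ 0 := by simpa using hr.ne'
        rw [lintegral_mul_const' _ _ (ENNReal.inv_ne_top.2 hr2), ← div_eq_mul_inv,
          lintegral_affineKernel_tsum_sq]
        gcongr
        exact tsum_risk_le hp hC hα hβ hR (fun i => (hκ i).1) hn hf₀ (fun _ => rfl) (fun _ => rfl)

end SeqModel

/-! ### The contraction rate -/

theorem theorem3p1
    (p C α β R : ℝ) (hp : 0 ≤ p) (hC : 1 ≤ C) (hα : 0 < α) (hβ : 0 < β) (hR : 0 < R)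
    (κ : ℕ → ℝ)
    (hκ : ∀ i : ℕ, C⁻¹ * ((i : ℝ) + 1) ^ (-p) ≤ κ i ∧ κ i ≤ C * ((i : ℝ) + 1) ^ (-p))
    (post : ℕ → Kernel (ℕ → ℝ) (ℕ → ℝ)) [∀ n, IsMarkovKernel (post n)]
    (hpost : ∀ n : ℕ, 1 ≤ n →
      SeqModel.IsPosterior (SeqModel.prior α) (SeqModel.sampleLaw κ n) (post n))
    (M : ℕ → ℝ) (hM : Tendsto M atTop atTop) :
    Tendsto
      (fun n : ℕ => ⨆ f₀ ∈ SeqModel.sobolevBall β R,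
        ∫⁻ Y, post n Y
            {f | ENNReal.ofReal (M n * (n : ℝ) ^ (-(min α β) / (1 + 2 * α + 2 * p)))
                  ≤ SeqModel.ell2Norm (f - f₀)}
          ∂(SeqModel.sampleLaw κ n f₀))
      atTop (𝓝 0) := by
  set K : ℝ := C ^ 4 * R ^ 2 + 2 * C ^ 2 * (1 + (2 * α)⁻¹ * 2 ^ (2 * α))
  have hlim : Tendsto (fun n => ENNReal.ofReal (K / M n ^ 2)) atTop (𝓝 0) := by
    rw [← ENNReal.ofReal_zero]
    exact ENNReal.tendsto_ofReal
      (Tendsto.const_div_atTop ((tendsto_pow_atTop two_ne_zero).comp hM) K)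
  refine tendsto_of_tendsto_of_tendsto_of_le_of_le' tendsto_const_nhds hlim
    (Eventually.of_forall fun _ => bot_le) ?_
  -- Markov's inequality needs a positive radius, hence `M n > 0`. The index `n = 0`, where `1 / √0
  -- = 0` removes the noise, is excluded.
  filter_upwards [hM.eventually_gt_atTop 0, eventually_ge_atTop 1] with n hMn hn
  have hn0 : (0 : ℝ) < n := by exact_mod_cast hn
  refine iSup₂_le fun f₀ hf₀ => ?_
  refine (SeqModel.lintegral_posterior_le hp hC hα hβ hR hκ hn (post n) (hpost n hn) hf₀
    (by positivity)).trans_eq ?_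
  rw [← ENNReal.ofReal_div_of_pos (by positivity)]
  congr 1
  have hsq : ((n : ℝ) ^ (-(min α β) / (1 + 2 * α + 2 * p))) ^ 2 =
      (n : ℝ) ^ (-(2 * min α β) / (1 + 2 * α + 2 * p)) := by
    rw [← Real.rpow_natCast, ← Real.rpow_mul hn0.le]
    congr 1
    push_cast
    ring
  rw [mul_pow, hsq]
  exact mul_div_mul_right _ _ (by positivity)
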